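/- Let $K$ players $k = 1, \dots, K$ have action sets $\mathbb{R}^{n_k}$ and twice continuously differentiable cost functions $f_k : \mathbb{R}^n \to \mathbb{R}$, where $n = n_1 + \cdots + n_K$ and $\mathbf{z} = (\mathbf{z}_1, \dots, \mathbf{z}_K) \in \mathbb{R}^n$ denotes a profile of actions $\mathbf{z}_k \in \mathbb{R}^{n_k}$. Write $F(\mathbf{z}) := (\nabla_{\mathbf{z}_1} f_1(\mathbf{z}), \dots, \nabla_{\mathbf{z}_K} f_K(\mathbf{z})) \in \mathbb{R}^n$ and let $\partial F$ be the Jacobian of $F$. All vector norms are Euclidean, and $\|\cdot\|_\sigma$ is the spectral norm. Suppose that the game is monotone, i.e. $\langle F(\mathbf{z}') - F(\mathbf{z}), \mathbf{z}' - \mathbf{z} \rangle \ge 0$ for all $\mathbf{z}, \mathbf{z}' \in \mathbb{R}^n$, and that for some $\ell, \Lambda > 0$ and all $\mathbf{z}, \mathbf{z}' \in \mathbb{R}^n$, $$\|F(\mathbf{z}) - F(\mathbf{z}')\| \le \ell \|\mathbf{z} - \mathbf{z}'\|, \qquad \|\partial F(\mathbf{z}) - \partial F(\mathbf{z}')\|_\sigma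 \le \Lambda \|\mathbf{z} - \mathbf{z}'\|.$$ Let $D > 0$ and $\mathbf{z}^{(-1)}, \mathbf{z}^{(0)} \in \mathbb{R}^n$, and suppose there is $\mathbf{z}^* \in \mathbb{R}^n$ with $F(\mathbf{z}^*) = 0$, $\|\mathbf{z}^* - \mathbf{z}^{(-1)}\| \le D$ and $\|\mathbf{z}^* - \mathbf{z}^{(0)}\| \le D$. Let $0 < \eta \le \min\left\{ \frac{1}{150 \ell}, \frac{1}{1711 D \Lambda} \right\}$ and define the iterates of the optimistic gradient (OG) algorithm by $$\mathbf{z}^{(t+1)} = \mathbf{z}^{(t)} - 2\eta F(\mathbf{z}^{(t)}) + \eta F(\mathbf{z}^{(t-1)}), \qquad t \ge 0.$$ For each $k$ let $\mathcal{Z}'_k := \{ \mathbf{u} \in \mathbb{R}^{n_k} : \|\mathbf{u} - \mathbf{z}^{(0)}_k\| \le 3D \}$, let $\mathcal{Z}' := \prod_{k=1}^K \mathcal{Z}'_k$, and let $$\mathrm{Gap}^{\mathcal{Z}'}(\mathbf{z}) := \sum_{k=1}^K \left( f_k(\mathbf{z}) - \min_{\mathbf{u} \in \mathcal{Z}'_k}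 f_k(\mathbf{u}, \mathbf{z}_{-k}) \right)$$ be the total gap function, where $(\mathbf{u}, \mathbf{z}_{-k})$ is $\mathbf{z}$ with its $k$-th block replaced by $\mathbf{u}$. Then for every integer $T \ge 1$, $$\mathrm{Gap}^{\mathcal{Z}'}(\mathbf{z}^{(T)}) \le \frac{180 K D^2}{\eta \sqrt{T}}.$$ -/

import Mathlib

/-- The space of action profiles `z = (z_1, …, z_K)`, where player `k` chooses an action in `ℝ^{n_k}`.
It is the Euclidean space `ℝ^{n_1 + ⋯ + n_K}` split into blocks, with the Euclidean norm and inner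
product. -/
abbrev Profile {K : ℕ} (n : Fin K → ℕ) : Type :=
  PiLp 2 (fun k : Fin K => EuclideanSpace ℝ (Fin (n k)))

/-- The profile `(u, z_{-k})`: player `k` plays `u`, all the others play as in `z`. -/
noncomputable def Profile.deviate {K : ℕ} {n : Fin K → ℕ} (z : Profile n) (k : Fin K)
    (u : EuclideanSpace ℝ (Fin (n k))) : Profile n :=
  WithLp.toLp 2 (Function.update (WithLp.ofLp z) k u)

/-- An unconstrained continuous game with `K` players and action sets `ℝ^{n_k}`: every player has a
twice continuously differentiable cost function, which the player wishes to minimize. -/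
structure ContinuousGame {K : ℕ} (n : Fin K → ℕ) where
  /-- The cost function of each player. -/
  cost : Fin K → Profile n → ℝ
  /-- The cost functions are twice continuously differentiable. -/
  contDiff_cost : ∀ k, ContDiff ℝ 2 (cost k)

namespace ContinuousGame

variable {K : ℕ} {n : Fin K → ℕ}

/-- The operator `F_G(z) = (∇_{z_1} f_1(z), …, ∇_{z_K} f_K(z))` of concatenated gradients, each player's
cost being differentiated with respect to the player's own action. -/
noncomputable def operator (G : ContinuousGame n) (z : Profile n) : Profile n :=
  WithLp.toLp 2 (fun k => gradient (fun u => G.cost k (z.deviate k u)) (z k))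

/-- The game is monotone: `⟨F_G(z') - F_G(z), z' - z⟩ ≥ 0` for all `z, z'`. -/
def IsMonotone (G : ContinuousGame n) : Prop :=
  ∀ z z' : Profile n, 0 ≤ inner ℝ (G.operator z' - G.operator z) (z' - z)

/-- First and second order smoothness of `F_G` with constants `ℓ, Λ > 0`. The Jacobian is the Fréchet
derivative, and its operator norm is the spectral norm. -/
structure IsSmooth (G : ContinuousGame n) (ℓ Λ : ℝ) : Prop where
  pos_first : 0 < ℓ
  pos_second : 0 < Λ
  lipschitz : ∀ z z' : Profile n, ‖G.operator z - G.operator z'‖ ≤ ℓ * ‖z - z'‖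
  jacobian_lipschitz : ∀ z z' : Profile n,
    ‖fderiv ℝ G.operator z - fderiv ℝ G.operator z'‖ ≤ Λ * ‖z - z'‖

/-- The total gap function at `z` with respect to (compact, nonempty) sets `Z'_k`:
`∑_k (f_k(z) - min_{u ∈ Z'_k} f_k(u, z_{-k}))`. -/
noncomputable def totalGap (G : ContinuousGame n) (Z' : (k : Fin K) → Set (EuclideanSpace ℝ (Fin (n k))))
    (z : Profile n) : ℝ :=
  ∑ k, (G.cost k z - sInf ((fun u => G.cost k (z.deviate k u)) '' Z' k))

/-- On a nonempty compact set the infimum in `totalGap` is a minimum. -/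
theorem isLeast_sInf_deviation (G : ContinuousGame n) (k : Fin K) (z : Profile n)
    {S : Set (EuclideanSpace ℝ (Fin (n k)))} (hS : IsCompact S) (hne : S.Nonempty) :
    IsLeast ((fun u => G.cost k (z.deviate k u)) '' S)
      (sInf ((fun u => G.cost k (z.deviate k u)) '' S)) := by
  have hd : Continuous (fun u => z.deviate k u) :=
    (PiLp.continuous_toLp 2 _).comp (continuous_const.update k continuous_id)
  have hc : Continuous (fun u => G.cost k (z.deviate k u)) :=
    (G.contDiff_cost k).continuous.comp hd
  exact (hS.image hc).isLeast_sInf (hne.image _)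

/-- The iterates `z^0, z^1, z^2, …` of the optimistic gradient algorithm with constant step size `η`
from `z^{-1}, z^0`, that is, `z^{t+1} = z^t - 2 η F_G(z^t) + η F_G(z^{t-1})` for all `t ≥ 0`. -/
noncomputable def ogIterate (G : ContinuousGame n) (η : ℝ) (zinit z0 : Profile n) : ℕ → Profile n
  | 0 => z0
  | 1 => z0 - (2 * η) • G.operator z0 + η • G.operator zinit
  | t + 2 => ogIterate G η zinit z0 (t + 1)
      - (2 * η) • G.operator (ogIterate G η zinit z0 (t + 1))
      + η • G.operator (ogIterate G η zinit z0 t)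

end ContinuousGame

/-!
The optimistic gradient method is the past extragradient method in disguise. After rescaling, let
`A = η • F`, which is monotone and Lipschitz with a constant `L ≤ 1/150`, and let `w 0, w 1, w 2, …`
be the points `z^{(-1)}, z^{(0)}, z^{(1)}, …`. The extrapolation centres `x t = w (t+1) + A (w t)`
satisfy `x (t+1) = x t - A (w (t+1))` and stay close to the iterates. Two potentials carry the proof.

* `‖x t - z*‖² + 2 ‖A (w (t+1)) - A (w t)‖² + (99/100) ∑_{s < t} ‖A (w s)‖²` does not increase
  (`OptimisticStep.energy_le`). This is the usual regret argument; it keeps the iterates within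
  `3 D` of `z*` and bounds the sum of all `‖A (w s)‖²` by a constant multiple of `D²`.
* `‖A (x t)‖² + 2 ‖A (x t) - A (w t)‖²` does not increase (`OptimisticStep.residual_succ_le`).
  Monotonicity enters here only between the consecutive centres `x t` and `x (t+1)`.

Since the second potential is, up to constants, dominated by the terms of the summable series, its
last value is `O(D²/T)`, so `‖F (z^{(T)})‖ = O(D / (η √T))`
(`OptimisticStep.norm_sq_operator_le`).

The gap is then linearized: monotonicity of the game makes each player's cost convex in the player's
own action, so each summand of the gap at `z` is at most `⟪F(z)_k, z_k - u⟫ ≤ ‖F(z)‖ · 7 D`.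
-/

/-! ### The optimistic gradient method for a monotone operator -/

/-- `w` is a run of the optimistic gradient method with unit step size for the operator `A`. The
indices are shifted by one: `w 0` and `w 1` are the two initial points `z^{(-1)}` and `z^{(0)}`. -/
def OptimisticStep {E : Type*} [AddCommGroup E] [Module ℝ E] (A : E → E) (w : ℕ → E) : Prop :=
  ∀ t, w (t + 2) = w (t + 1) - (2 : ℝ) • A (w (t + 1)) + A (w t)

namespace OptimisticStep

theorem norm_sq_le_of_lipschitz {E : Type*} [SeminormedAddCommGroup E] {A : E → E} {L : ℝ}
    (hlip : ∀ x y, ‖A x - A y‖ ≤ L * ‖x - y‖)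
    (hL : L ≤ 1 / 150) (x y : E) : ‖A x - A y‖ ^ 2 ≤ 1 / 22500 * ‖x - y‖ ^ 2 := by
  have h : ‖A x - A y‖ ≤ 1 / 150 * ‖x - y‖ :=
    (hlip x y).trans (mul_le_mul_of_nonneg_right hL (norm_nonneg _))
  calc ‖A x - A y‖ ^ 2 ≤ (1 / 150 * ‖x - y‖) ^ 2 := pow_le_pow_left₀ (norm_nonneg _) h 2
    _ = 1 / 22500 * ‖x - y‖ ^ 2 := by ring

variable {E : Type*} [NormedAddCommGroup E] [InnerProductSpace ℝ E] {A : E → E} {w : ℕ → E}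

/-- The extrapolation centre: the `t`-th iterate of the equivalent past extragradient method, which
moves by `-A (w (t+1))`, see `centre_succ`. -/
def centre (A : E → E) (w : ℕ → E) (t : ℕ) : E := w (t + 1) + A (w t)

theorem centre_succ (hw : OptimisticStep A w) (t : ℕ) :
    centre A w (t + 1) = centre A w t - A (w (t + 1)) := by
  simp only [centre, hw t, two_smul]
  abel

theorem norm_add_sq_le_two_mul (x y : E) : ‖x + y‖ ^ 2 ≤ 2 * ‖x‖ ^ 2 + 2 * ‖y‖ ^ 2 := by
  nlinarith [parallelogram_law_with_norm ℝ x y, sq_nonneg ‖x - y‖]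

/-- One step of the regret argument, comparing the run with a zero `zstar` of the operator. -/
theorem norm_sq_centre_succ_sub_le (hw : OptimisticStep A w)
    (hmono : ∀ x y, 0 ≤ inner ℝ (A y - A x) (y - x)) {zstar : E} (hz : A zstar = 0) (t : ℕ) :
    ‖centre A w (t + 1) - zstar‖ ^ 2 ≤
      ‖centre A w t - zstar‖ ^ 2 - ‖A (w t)‖ ^ 2 + ‖A (w (t + 1)) - A (w t)‖ ^ 2 := by
  have hm := hmono zstar (w (t + 1))
  rw [hz, sub_zero] at hm
  have h1 : centre A w (t + 1) - zstar = (w (t + 1) - zstar) + (A (w t) - A (w (t + 1))) := by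
    rw [centre_succ hw, centre]; abel
  have h2 : centre A w t - zstar = (w (t + 1) - zstar) + A (w t) := by
    rw [centre]; abel
  rw [h1, h2, norm_add_sq_real, norm_add_sq_real, inner_sub_right,
    norm_sub_rev (A (w (t + 1))) (A (w t)),
    real_inner_comm (A (w (t + 1))) (w (t + 1) - zstar)]
  linarith

theorem norm_sq_operator_sub_succ_le (hw : OptimisticStep A w)
    (hlip : ∀ x y, ‖A x - A y‖ ^ 2 ≤ 1 / 22500 * ‖x - y‖ ^ 2) (t : ℕ) :
    ‖A (w (t + 2)) - A (w (t + 1))‖ ^ 2 ≤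
      1 / 22500 * (2 * ‖A (w t)‖ ^ 2 + 8 * ‖A (w (t + 1)) - A (w t)‖ ^ 2) := by
  have h := hlip (w (t + 2)) (w (t + 1))
  have h1 : w (t + 2) - w (t + 1) = -(A (w t) + (2 : ℝ) • (A (w (t + 1)) - A (w t))) := by
    rw [hw t]; simp only [two_smul]; abel
  rw [h1, norm_neg] at h
  have h2 := norm_add_sq_le_two_mul (A (w t)) ((2 : ℝ) • (A (w (t + 1)) - A (w t)))
  rw [norm_smul, Real.norm_ofNat, mul_pow] at h2
  linarith

/-- The energy, with the accumulated squared operator norms, stays below its initial value. The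
initial value is at most `(D + L D)² + 2 (2 L D)²`. -/
theorem energy_le (hw : OptimisticStep A w) (hmono : ∀ x y, 0 ≤ inner ℝ (A y - A x) (y - x))
    (hlip : ∀ x y, ‖A x - A y‖ ^ 2 ≤ 1 / 22500 * ‖x - y‖ ^ 2) {zstar : E} (hz : A zstar = 0)
    {D : ℝ} (hinit : ‖zstar - w 0‖ ≤ D) (h0 : ‖zstar - w 1‖ ≤ D) (t : ℕ) :
    ‖centre A w t - zstar‖ ^ 2 + 2 * ‖A (w (t + 1)) - A (w t)‖ ^ 2 +
      99 / 100 * ∑ s ∈ Finset.range t, ‖A (w s)‖ ^ 2 ≤ 102 / 100 * D ^ 2 := by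
  induction t with
  | zero =>
    have hD : 0 ≤ D := (norm_nonneg _).trans h0
    have ha : ‖A (w 0)‖ ≤ 1 / 150 * D := by
      refine le_of_sq_le_sq ?_ (by positivity)
      have h := hlip (w 0) zstar
      rw [hz, sub_zero, norm_sub_rev] at h
      have : ‖zstar - w 0‖ ^ 2 ≤ D ^ 2 := pow_le_pow_left₀ (norm_nonneg _) hinit 2
      nlinarith
    have hx : ‖centre A w 0 - zstar‖ ≤ 151 / 150 * D := by
      have : centre A w 0 - zstar = (w 1 - zstar) + A (w 0) := by
        rw [centre]; abel
      rw [this]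
      have := norm_add_le (w 1 - zstar) (A (w 0))
      rw [norm_sub_rev] at this
      linarith
    have hd : ‖w 1 - w 0‖ ≤ 2 * D := by
      have := norm_sub_le_norm_sub_add_norm_sub (w 1) zstar (w 0)
      rw [norm_sub_rev (w 1) zstar] at this
      linarith
    have hd2 : ‖w 1 - w 0‖ ^ 2 ≤ (2 * D) ^ 2 := pow_le_pow_left₀ (norm_nonneg _) hd 2
    have hx2 : ‖centre A w 0 - zstar‖ ^ 2 ≤ (151 / 150 * D) ^ 2 :=
      pow_le_pow_left₀ (norm_nonneg _) hx 2
    have h1 := hlip (w 1) (w 0)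
    simp only [Finset.range_zero, Finset.sum_empty, zero_add]
    nlinarith [sq_nonneg D]
  | succ t ih =>
    have h1 := norm_sq_centre_succ_sub_le hw hmono hz t
    have h2 := norm_sq_operator_sub_succ_le hw hlip t
    rw [Finset.sum_range_succ]
    -- One copy of `‖A (w (t+1)) - A (w t)‖²` pays for the error in `h1`, the other for the small
    -- multiple of it in `h2`; the new term of the sum is paid for by `-‖A (w t)‖²` in `h1`.
    linarith [sq_nonneg ‖A (w t)‖, sq_nonneg ‖A (w (t + 1)) - A (w t)‖]

theorem norm_sq_operator_centre_succ_sub_le (hw : OptimisticStep A w)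
    (hlip : ∀ x y, ‖A x - A y‖ ^ 2 ≤ 1 / 22500 * ‖x - y‖ ^ 2) (t : ℕ) :
    ‖A (centre A w (t + 1)) - A (w (t + 1))‖ ^ 2 ≤
      1 / 22500 * ‖A (w t) - A (w (t + 1))‖ ^ 2 := by
  have h := hlip (centre A w (t + 1)) (w (t + 1))
  have h1 : centre A w (t + 1) - w (t + 1) = A (w t) - A (w (t + 1)) := by
    rw [centre_succ hw, centre]; abel
  rwa [h1] at h

/-- The residual at the centres, corrected by its distance to the last gradient used, decreases.
Monotonicity between two consecutive centres, whose difference is `-A (w (t+1))`, compares the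
squared norms of the operator; the Lipschitz bound absorbs the error. -/
theorem residual_succ_le (hw : OptimisticStep A w)
    (hmono : ∀ x y, 0 ≤ inner ℝ (A y - A x) (y - x))
    (hlip : ∀ x y, ‖A x - A y‖ ^ 2 ≤ 1 / 22500 * ‖x - y‖ ^ 2) (t : ℕ) :
    ‖A (centre A w (t + 1))‖ ^ 2 + 2 * ‖A (centre A w (t + 1)) - A (w (t + 1))‖ ^ 2 ≤
      ‖A (centre A w t)‖ ^ 2 + 2 * ‖A (centre A w t) - A (w t)‖ ^ 2 := by
  have hm := hmono (centre A w t) (centre A w (t + 1))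
  have h1 : centre A w (t + 1) - centre A w t = -A (w (t + 1)) := by
    rw [centre_succ hw]; abel
  rw [h1, inner_neg_right, inner_sub_left] at hm
  have h2 := norm_sq_operator_centre_succ_sub_le hw hlip t
  have h3 := norm_sub_sq_real (A (centre A w (t + 1))) (A (w (t + 1)))
  have h4 := norm_sub_sq_real (A (centre A w t)) (A (w (t + 1)))
  have h5 := norm_add_sq_le_two_mul (A (w t) - A (centre A w t))
    (A (centre A w t) - A (w (t + 1)))
  rw [sub_add_sub_cancel, norm_sub_rev (A (w t)) (A (centre A w t))] at h5
  linarith [sq_nonneg ‖A (centre A w t) - A (w (t + 1))‖, sq_nonneg ‖A (centre A w t) - A (w t)‖]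

theorem norm_sub_le (hw : OptimisticStep A w) (hmono : ∀ x y, 0 ≤ inner ℝ (A y - A x) (y - x))
    (hlip : ∀ x y, ‖A x - A y‖ ^ 2 ≤ 1 / 22500 * ‖x - y‖ ^ 2) {zstar : E} (hz : A zstar = 0)
    {D : ℝ} (hinit : ‖zstar - w 0‖ ≤ D) (h0 : ‖zstar - w 1‖ ≤ D) (t : ℕ) :
    ‖w (t + 1) - zstar‖ ≤ 3 * D := by
  have hD : 0 ≤ D := (norm_nonneg _).trans h0
  have hx := energy_le hw hmono hlip hz hinit h0 t
  have ha := energy_le hw hmono hlip hz hinit h0 (t + 1)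
  rw [Finset.sum_range_succ] at ha
  have hs : 0 ≤ ∑ s ∈ Finset.range t, ‖A (w s)‖ ^ 2 := Finset.sum_nonneg fun _ _ => sq_nonneg _
  have h := norm_add_sq_le_two_mul (centre A w t - zstar) (-A (w t))
  rw [norm_neg] at h
  have h1 : (centre A w t - zstar) + -A (w t) = w (t + 1) - zstar := by
    rw [centre]; abel
  rw [h1] at h
  refine le_of_sq_le_sq ?_ (by positivity)
  nlinarith [sq_nonneg ‖centre A w (t + 1) - zstar‖, sq_nonneg ‖A (w (t + 1)) - A (w t)‖,
    sq_nonneg ‖A (w (t + 2)) - A (w (t + 1))‖, sq_nonneg D]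

/-- The last iterate satisfies `‖A (w (T+1))‖² = O(D² / T)`. -/
theorem norm_sq_operator_le (hw : OptimisticStep A w)
    (hmono : ∀ x y, 0 ≤ inner ℝ (A y - A x) (y - x))
    (hlip : ∀ x y, ‖A x - A y‖ ^ 2 ≤ 1 / 22500 * ‖x - y‖ ^ 2) {zstar : E} (hz : A zstar = 0)
    {D : ℝ} (hinit : ‖zstar - w 0‖ ≤ D) (h0 : ‖zstar - w 1‖ ≤ D) (T : ℕ) :
    T * ‖A (w (T + 1))‖ ^ 2 ≤ 16 * D ^ 2 := by
  set Φ : ℕ → ℝ := fun t =>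
    ‖A (centre A w t)‖ ^ 2 + 2 * ‖A (centre A w t) - A (w t)‖ ^ 2 with hΦ
  have hanti : Antitone Φ := antitone_nat_of_succ_le fun t => residual_succ_le hw hmono hlip t
  have hterm : ∀ t, Φ (t + 1) ≤ 3 * ‖A (w (t + 1))‖ ^ 2 + ‖A (w t)‖ ^ 2 := by
    intro t
    have h1 := norm_sq_operator_centre_succ_sub_le hw hlip t
    have h2 := norm_add_sq_le_two_mul (A (centre A w (t + 1)) - A (w (t + 1))) (A (w (t + 1)))
    have h3 := norm_add_sq_le_two_mul (A (w t)) (-A (w (t + 1)))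
    rw [sub_add_cancel] at h2
    rw [norm_neg, ← sub_eq_add_neg] at h3
    simp only [hΦ]
    linarith [sq_nonneg ‖A (w t)‖, sq_nonneg ‖A (w (t + 1))‖]
  have hsum : T * Φ T ≤ 4 * ∑ s ∈ Finset.range (T + 1), ‖A (w s)‖ ^ 2 := by
    calc T * Φ T = ∑ _t ∈ Finset.range T, Φ T := by simp
      _ ≤ ∑ t ∈ Finset.range T, (3 * ‖A (w (t + 1))‖ ^ 2 + ‖A (w t)‖ ^ 2) :=
        Finset.sum_le_sum fun t ht => (hanti (Finset.mem_range.1 ht)).trans (hterm t)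
      _ = 3 * ∑ t ∈ Finset.range T, ‖A (w (t + 1))‖ ^ 2
          + ∑ t ∈ Finset.range T, ‖A (w t)‖ ^ 2 := by
        rw [Finset.sum_add_distrib, Finset.mul_sum]
      _ ≤ 4 * ∑ s ∈ Finset.range (T + 1), ‖A (w s)‖ ^ 2 := by
        have h1 := Finset.sum_range_succ' (fun s => ‖A (w s)‖ ^ 2) T
        have h2 := Finset.sum_range_succ (fun s => ‖A (w s)‖ ^ 2) T
        linarith [sq_nonneg ‖A (w 0)‖, sq_nonneg ‖A (w T)‖]
  have hlast : ‖A (w (T + 1))‖ ^ 2 ≤ 3 * Φ T := by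
    have h1 := hlip (w (T + 1)) (centre A w T)
    have h2 : w (T + 1) - centre A w T = -A (w T) := by rw [centre]; abel
    rw [h2, norm_neg] at h1
    have h3 := norm_add_sq_le_two_mul (A (w (T + 1)) - A (centre A w T)) (A (centre A w T))
    have h4 := norm_add_sq_le_two_mul (A (centre A w T)) (-(A (centre A w T) - A (w T)))
    have h5 : A (centre A w T) + -(A (centre A w T) - A (w T)) = A (w T) := by abel
    rw [h5, norm_neg] at h4
    rw [sub_add_cancel] at h3
    simp only [hΦ]
    linarith [sq_nonneg ‖A (centre A w T)‖, sq_nonneg ‖A (centre A w T) - A (w T)‖]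
  have he := energy_le hw hmono hlip hz hinit h0 (T + 1)
  have hT := mul_le_mul_of_nonneg_left hlast (Nat.cast_nonneg (α := ℝ) T)
  nlinarith [sq_nonneg ‖centre A w (T + 1) - zstar‖,
    sq_nonneg ‖A (w (T + 2)) - A (w (T + 1))‖, sq_nonneg D]

end OptimisticStep

/-! ### Convexity in a player's own action and the linearized gap -/

/-- A differentiable function with monotone gradient lies above its tangents. -/
theorem sub_le_inner_gradient_of_monotone {E : Type*} [NormedAddCommGroup E]
    [InnerProductSpace ℝ E] [CompleteSpace E] {φ : E → ℝ} (hφ : Differentiable ℝ φ)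
    (hmono : ∀ x y, 0 ≤ inner ℝ (gradient φ y - gradient φ x) (y - x)) (x y : E) :
    φ x - φ y ≤ inner ℝ (gradient φ x) (x - y) := by
  have hderiv : ∀ s : ℝ, HasDerivAt (fun s : ℝ => φ (x + s • (y - x)))
      (inner ℝ (gradient φ (x + s • (y - x))) (y - x)) s := by
    intro s
    have h1 : HasDerivAt (fun s : ℝ => x + s • (y - x)) (y - x) s := by
      simpa using ((hasDerivAt_id s).smul_const (y - x)).const_add x
    have h2 := (hφ (x + s • (y - x))).hasGradientAt.hasFDerivAt.comp_hasDerivAt s h1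
    rwa [InnerProductSpace.toDual_apply_apply] at h2
  obtain ⟨s, hs, hslope⟩ := exists_hasDerivAt_eq_slope _ _ zero_lt_one
    (fun s _ => (hderiv s).continuousAt.continuousWithinAt) (fun s _ => hderiv s)
  simp only [one_smul, zero_smul, add_zero, sub_zero, div_one, add_sub_cancel] at hslope
  have hm := hmono x (x + s • (y - x))
  rw [add_sub_cancel_left, inner_smul_right, inner_sub_left] at hm
  have hm' := nonneg_of_mul_nonneg_right hm hs.1
  rw [← neg_sub y x, inner_neg_right]
  linarith

namespace Profile

variable {K : ℕ} {n : Fin K → ℕ}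

theorem deviate_deviate (z : Profile n) (k : Fin K) (u v : EuclideanSpace ℝ (Fin (n k))) :
    (z.deviate k u).deviate k v = z.deviate k v := by
  simp [deviate]

theorem deviate_self (z : Profile n) (k : Fin K) : z.deviate k (z k) = z := by
  simp [deviate]

theorem deviate_apply_same (z : Profile n) (k : Fin K) (u : EuclideanSpace ℝ (Fin (n k))) :
    (z.deviate k u) k = u := by
  simp [deviate]

theorem deviate_sub_deviate (z : Profile n) (k : Fin K) (u v : EuclideanSpace ℝ (Fin (n k))) :
    z.deviate k u - z.deviate k v = PiLp.single 2 k (u - v) := by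
  ext j : 1
  by_cases h : j = k
  · subst h; simp [deviate]
  · simp [deviate, h]

theorem contDiff_deviate (z : Profile n) (k : Fin K) :
    ContDiff ℝ 1 (fun u => z.deviate k u) :=
  (PiLp.contDiff_toLp).comp (contDiff_update 1 _ k)

end Profile

namespace ContinuousGame

variable {K : ℕ} {n : Fin K → ℕ}

theorem operator_deviate (G : ContinuousGame n) (z : Profile n) (k : Fin K)
    (u : EuclideanSpace ℝ (Fin (n k))) :
    G.operator (z.deviate k u) k = gradient (fun v => G.cost k (z.deviate k v)) u := by
  simp only [operator, Profile.deviate_deviate, Profile.deviate_apply_same]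

/-- In a monotone game every player's cost is convex in the player's own action, so a unilateral
deviation gains at most what the player's own gradient predicts. -/
theorem cost_sub_cost_deviate_le (G : ContinuousGame n) (hmono : G.IsMonotone) (z : Profile n)
    (k : Fin K) (u : EuclideanSpace ℝ (Fin (n k))) :
    G.cost k z - G.cost k (z.deviate k u) ≤ inner ℝ (G.operator z k) (z k - u) := by
  have hdiff : Differentiable ℝ (fun v => G.cost k (z.deviate k v)) :=
    ((G.contDiff_cost k).differentiable (by norm_num)).comp
      ((z.contDiff_deviate k).differentiable one_ne_zero)
  have h := sub_le_inner_gradient_of_monotone hdiff (fun x y => by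
    have hm := hmono (z.deviate k x) (z.deviate k y)
    rw [Profile.deviate_sub_deviate, PiLp.inner_apply, Finset.sum_eq_single k] at hm
    · simpa [operator_deviate] using hm
    · intro j _ hj
      simp [hj]
    · simp) (z k) u
  rwa [← operator_deviate, Profile.deviate_self] at h

/-- The total gap is controlled by the operator norm and the distance to the comparators. -/
theorem totalGap_closedBall_le (G : ContinuousGame n) (hmono : G.IsMonotone) (z z0 : Profile n)
    {r R : ℝ} (hr : 0 ≤ r) (hz : ‖z - z0‖ ≤ R) :
    G.totalGap (fun k => Metric.closedBall (z0 k) r) z ≤ K * (‖G.operator z‖ * (R + r)) := by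
  have hk : ∀ k, G.cost k z -
      sInf ((fun u => G.cost k (z.deviate k u)) '' Metric.closedBall (z0 k) r) ≤
        ‖G.operator z‖ * (R + r) := by
    intro k
    obtain ⟨u, hu, hmin⟩ := (G.isLeast_sInf_deviation k z (isCompact_closedBall (z0 k) r)
      (Metric.nonempty_closedBall.2 hr)).1
    rw [← hmin]
    have hzu : ‖z k - u‖ ≤ R + r := by
      have h1 := norm_sub_le_norm_sub_add_norm_sub (z k) (z0 k) u
      have h2 : ‖z k - z0 k‖ ≤ ‖z - z0‖ := PiLp.norm_apply_le (z - z0) k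
      rw [Metric.mem_closedBall, dist_comm, dist_eq_norm] at hu
      linarith
    calc G.cost k z - G.cost k (z.deviate k u) ≤ inner ℝ (G.operator z k) (z k - u) :=
          G.cost_sub_cost_deviate_le hmono z k u
      _ ≤ ‖G.operator z k‖ * ‖z k - u‖ := real_inner_le_norm _ _
      _ ≤ ‖G.operator z‖ * (R + r) :=
        mul_le_mul (PiLp.norm_apply_le (G.operator z) k) hzu (norm_nonneg _) (norm_nonneg _)
  calc G.totalGap (fun k => Metric.closedBall (z0 k) r) z
      ≤ ∑ _k : Fin K, ‖G.operator z‖ * (R + r) := Finset.sum_le_sum fun k _ => hk k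
    _ = K * (‖G.operator z‖ * (R + r)) := by simp

/-- The initial point `z^{(-1)}` followed by the optimistic gradient iterates is a run of the unit
step method for the rescaled operator. -/
theorem optimisticStep_ogIterate (G : ContinuousGame n) (η : ℝ) (zinit z0 : Profile n) :
    OptimisticStep (fun z => η • G.operator z)
      (fun t => Nat.casesOn t zinit (G.ogIterate η zinit z0)) := by
  intro t
  cases t <;> simp [ogIterate, smul_smul]

end ContinuousGame

theorem corollary2 {K : ℕ} {n : Fin K → ℕ} (G : ContinuousGame n) (hmono : G.IsMonotone)
    (ℓ Λ : ℝ) (hsmooth : G.IsSmooth ℓ Λ)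
    (zinit z0 zstar : Profile n) (D : ℝ) (hD : 0 < D)
    (hzstar : G.operator zstar = 0)
    (hinit : ‖zstar - zinit‖ ≤ D) (h0 : ‖zstar - z0‖ ≤ D)
    (η : ℝ) (hη : 0 < η) (hη_le : η ≤ min (1 / (150 * ℓ)) (1 / (1711 * D * Λ)))
    (T : ℕ) (hT : 1 ≤ T) :
    G.totalGap (fun k => Metric.closedBall (z0 k) (3 * D)) (G.ogIterate η zinit z0 T)
      ≤ 180 * (K : ℝ) * D ^ 2 / (η * Real.sqrt (T : ℝ)) := by
  have hℓ := hsmooth.pos_first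
  have hL : η * ℓ ≤ 1 / 150 := by
    have h := hη_le.trans (min_le_left _ _)
    rw [le_div_iff₀ (by positivity)] at h
    linarith
  have hw := G.optimisticStep_ogIterate η zinit z0
  have hm : ∀ x y : Profile n,
      0 ≤ inner ℝ (η • G.operator y - η • G.operator x) (y - x) := fun x y => by
    rw [← smul_sub, real_inner_smul_left]
    exact mul_nonneg hη.le (hmono x y)
  have hlip : ∀ x y : Profile n,
      ‖η • G.operator x - η • G.operator y‖ ^ 2 ≤ 1 / 22500 * ‖x - y‖ ^ 2 :=
    OptimisticStep.norm_sq_le_of_lipschitz (L := η * ℓ) (fun x y => by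
      rw [← smul_sub, norm_smul, Real.norm_of_nonneg hη.le, mul_assoc]
      exact mul_le_mul_of_nonneg_left (hsmooth.lipschitz x y) hη.le) hL
  have hz : η • G.operator zstar = 0 := by rw [hzstar, smul_zero]
  have hdist : ‖G.ogIterate η zinit z0 T - zstar‖ ≤ 3 * D :=
    hw.norm_sub_le hm hlip hz hinit h0 T
  have hop : T * ‖η • G.operator (G.ogIterate η zinit z0 T)‖ ^ 2 ≤ 16 * D ^ 2 :=
    hw.norm_sq_operator_le hm hlip hz hinit h0 T
  have hT0 : (0 : ℝ) < T := by exact_mod_cast hT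
  have hs : 0 < η * Real.sqrt T := mul_pos hη (Real.sqrt_pos.2 hT0)
  have hF : ‖G.operator (G.ogIterate η zinit z0 T)‖ * (η * Real.sqrt T) ≤ 4 * D := by
    refine le_of_sq_le_sq ?_ (by positivity)
    rw [norm_smul, Real.norm_of_nonneg hη.le] at hop
    rw [mul_pow, mul_pow, Real.sq_sqrt hT0.le]
    linarith
  have hz0 : ‖G.ogIterate η zinit z0 T - z0‖ ≤ 4 * D := by
    have := norm_sub_le_norm_sub_add_norm_sub (G.ogIterate η zinit z0 T) zstar z0
    linarith
  refine (G.totalGap_closedBall_le hmono _ z0 (by positivity) hz0).trans ?_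
  rw [le_div_iff₀ hs]
  have hKD : (0 : ℝ) ≤ K * (7 * D) := by positivity
  nlinarith [mul_le_mul_of_nonneg_left hF hKD, mul_nonneg (Nat.cast_nonneg (α := ℝ) K) (sq_nonneg D)]
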